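/- Let $\mathcal{A}$ be a complex Banach algebra with identity. For a ring $R$ with identity, an element $a\in R$ is quasinilpotent if $1+ax$ is invertible for every $x\in R$ with $xa=ax$; $a$ is g-Drazin invertible if there is $b\in R$ with $ba=ab$, $b=bab$ and $a-a^2b$ quasinilpotent. In $\mathcal{A}$ and in $M_2(\mathcal{A})$ such a $b$ is unique; it is denoted by $a^d$, and $a^\pi=1-aa^d$. Let $A,B,C,D\in\mathcal{A}$ be such that $A$, $D$ and $BC$ are g-Drazin invertible (then so is $CB$), and put $$M=\begin{pmatrix}A&B\\C&D\end{pmatrix},\quad P=\begin{pmatrix}A&0\\0&D\end{pmatrix},\quad Q=\begin{pmatrix}0&B\\C&0\end{pmatrix}\in M_2(\mathcal{A}).$$ Let $\lambda$ be a nonzero complex number. If $$BD=\lambda (BC)^\pi A B D^\pi\quad\text{and}\quad CA=\lambda (CB)^\pi D C A^\pi,$$ then $P$, $Q$ and $M$ are g-Drazin invertible in $M_2(\mathcal{A})$, all the series below converge, and $$\begin{aligned}M^d=&\begin{pmatrix}A^d(BC)^\pi & A^\pi B(CB)^d\\ D^\pi C(BC)^d & D^d(CB)^\pi\end{pmatrix}+\sum_{n=0}^\infty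 (P^d)^{n+2}QM^nQ^\pi+P^\pi\sum_{n=0}^\infty M^nP(Q^d)^{n+2}\\&-\sum_{n=0}^\infty\sum_{k=0}^\infty (P^d)^{k+1}QM^{n+k}P(Q^d)^{n+2}-\sum_{n=0}^\infty (P^d)^{n+2}QM^nPQ^d.\end{aligned}$$ -/

import Mathlib

namespace GDrazin

/-- `a` is quasinilpotent: `1 + a * x` is a unit for every `x` in the commutant of `a`. -/
def IsQuasinilpotent {R : Type*} [Ring R] (a : R) : Prop :=
  ∀ x : R, x * a = a * x → IsUnit (1 + a * x)

/-- `b` is a generalized Drazin inverse of `a`. -/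
structure IsGDrazinInverse {R : Type*} [Ring R] (a b : R) : Prop where
  comm : b * a = a * b
  outer : b = b * a * b
  quasinilpotent : IsQuasinilpotent (a - a ^ 2 * b)

/-- `a` has a generalized Drazin inverse. -/
def IsGDrazinInvertible {R : Type*} [Ring R] (a : R) : Prop :=
  ∃ b : R, IsGDrazinInverse a b

open Classical in
/-- The generalized Drazin inverse of `a` (with the value `0` if there is none). In a complex
Banach algebra an element has at most one generalized Drazin inverse. -/
noncomputable def gDrazinInv {R : Type*} [Ring R] (a : R) : R :=
  if h : IsGDrazinInvertible a then h.choose else 0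

/-- The spectral idempotent `1 - a * aᵈ` of `a`. -/
noncomputable def spectralIdem {R : Type*} [Ring R] (a : R) : R :=
  1 - a * gDrazinInv a

end GDrazin

/-!
Write `aᵈ` for the generalized Drazin inverse and `aᵖ = 1 - a * aᵈ`. The two hypotheses on the
entries say precisely that `Q * P = l • (Qᵖ * P * Q * Pᵖ)`. Multiplying by `Qᵈ` on the left or by
`Pᵈ` on the right gives `Qᵈ * P = 0` and `Q * Pᵈ = 0`, so the hypothesis collapses to the twisted
commutation rule `Q * P = l • (P * Q)`
(`IsGDrazinInverse.twisted_commute_of_eq_smul_spectral`).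

Twisted commutation forces the two remaining products to vanish as well: `x = Pᵈ * Q` satisfies
`x = w * x * q` with `q = P * Pᵖ` quasinilpotent, and iterating this relation gives `x = 0`
because the powers of `q` decay faster than every geometric sequence; similarly `P * Qᵈ = 0`.
Hence every term of every series in the formula is zero and the formula reduces to
`Mᵈ = Pᵈ + Qᵈ`. Its only nontrivial part is that `P * Pᵖ + Q * Qᵖ` is quasinilpotent: these
summands again commute up to the factor `l`, and `IsQuasinilpotent.add_of_mul_eq_smul_mul` shows
that a sum of two such quasinilpotents is quasinilpotent.

The analytic input is the Gelfand formula, which identifies quasinilpotence in the sense of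
invertibility with superexponential decay of `‖a ^ n‖`
(`isQuasinilpotent_iff_isUnit`, `isQuasinilpotent_iff_norm_pow_le`). It applies to
`2 × 2` matrices through the `ℓ∞` operator norm, and it also gives uniqueness of generalized Drazin
inverses. The inverses of `P` and `Q` are written down explicitly; that of `C * B` comes from
Cline's formula `(C * B)ᵈ = C * (B * C)ᵈ ^ 2 * B`.
-/

namespace GDrazin

/-! ### Quasinilpotent elements of a Banach algebra -/

section Quasinilpotent

variable {R : Type*} [NormedRing R]

/-- The powers of `a` decay faster than every geometric sequence. -/
def HasSuperexpDecay (a : R) : Prop :=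
  ∀ ε : ℝ, 0 < ε → ∃ K : ℝ, 0 ≤ K ∧ ∀ n : ℕ, ‖a ^ n‖ ≤ K * ε ^ n

theorem HasSuperexpDecay.tendsto_mul_pow {a : R} (ha : HasSuperexpDecay a) {r : ℝ} (hr : 0 ≤ r) :
    Filter.Tendsto (fun n : ℕ => ‖a ^ n‖ * r ^ n) Filter.atTop (nhds 0) := by
  obtain ⟨K, -, hK⟩ := ha (1 / (2 * (r + 1))) (by positivity)
  have hlim : Filter.Tendsto (fun n : ℕ => K * (r / (2 * (r + 1))) ^ n) Filter.atTop (nhds 0) := by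
    have h := (tendsto_pow_atTop_nhds_zero_of_lt_one (r := r / (2 * (r + 1))) (by positivity)
      (by rw [div_lt_one (by positivity)]; linarith)).const_mul K
    simpa using h
  refine squeeze_zero (fun n => by positivity) (fun n => ?_) hlim
  calc ‖a ^ n‖ * r ^ n ≤ K * (1 / (2 * (r + 1))) ^ n * r ^ n := by gcongr; exact hK n
    _ = K * (r / (2 * (r + 1))) ^ n := by rw [mul_assoc, ← mul_pow]; ring_nf

theorem HasSuperexpDecay.isQuasinilpotent [CompleteSpace R] {a : R} (ha : HasSuperexpDecay a) :
    IsQuasinilpotent a := by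
  intro x hx
  obtain ⟨n, hn, hn0⟩ := (((ha.tendsto_mul_pow (norm_nonneg x)).eventually_lt_const
    one_pos).and (Filter.eventually_gt_atTop 0)).exists
  have hlt : ‖(-(a * x)) ^ n‖ < 1 := by
    rw [neg_pow, (show Commute a x from hx.symm).mul_pow]
    refine lt_of_le_of_lt ?_ hn
    have h1 : ‖(-1 : R) ^ n * (a ^ n * x ^ n)‖ = ‖a ^ n * x ^ n‖ := by
      rcases neg_one_pow_eq_or R n with h | h <;> simp [h]
    rw [h1]
    exact (norm_mul_le _ _).trans (by gcongr; exact norm_pow_le' x hn0)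
  have hu := isUnit_one_sub_of_norm_lt_one hlt
  rw [← mul_neg_geom_sum] at hu
  have hc : Commute (1 - -(a * x)) (∑ i ∈ Finset.range n, (-(a * x)) ^ i) := by
    rw [Commute, SemiconjBy, mul_neg_geom_sum, geom_sum_mul_neg]
  simpa using (hc.isUnit_mul_iff.1 hu).1

variable [NormedAlgebra ℂ R]

theorem IsQuasinilpotent.isUnit_one_add_smul {a : R} (ha : IsQuasinilpotent a) (z : ℂ) :
    IsUnit (1 + z • a) := by
  have h := ha (z • 1) (by simp)
  simpa using h

theorem spectralRadius_eq_zero_of_isUnit {a : R} (ha : ∀ z : ℂ, IsUnit (1 + z • a)) :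
    spectralRadius ℂ a = 0 := by
  unfold spectralRadius
  simp only [ENNReal.iSup_eq_zero]
  intro k hk
  by_contra hk0
  have hk' : k ≠ 0 := fun h => hk0 (by simp [h])
  rw [spectrum.mem_iff] at hk
  apply hk
  have h : algebraMap ℂ R k - a = k • (1 + (-k⁻¹) • a) := by
    rw [smul_add, smul_smul, mul_neg, mul_inv_cancel₀ hk', Algebra.algebraMap_eq_smul_one]
    simp [sub_eq_add_neg]
  rw [h]
  exact (ha _).smul (Units.mk0 k hk')

theorem hasSuperexpDecay_of_spectralRadius_eq_zero [CompleteSpace R] {a : R}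
    (ha : spectralRadius ℂ a = 0) : HasSuperexpDecay a := by
  intro ε hε
  have ht := spectrum.pow_norm_pow_one_div_tendsto_nhds_spectralRadius a
  rw [ha] at ht
  have hev : ∀ᶠ n : ℕ in Filter.atTop, ‖a ^ n‖ / ε ^ n ≤ 1 := by
    filter_upwards [ht.eventually_lt_const (ENNReal.ofReal_pos.2 hε), Filter.eventually_gt_atTop 0]
      with n hn hn0
    rw [ENNReal.ofReal_lt_ofReal_iff hε] at hn
    rw [div_le_one (pow_pos hε n)]
    have h := pow_le_pow_left₀ (by positivity) hn.le n
    rwa [one_div, Real.rpow_inv_natCast_pow (norm_nonneg _) hn0.ne'] at h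
  obtain ⟨K, hK⟩ := (Filter.isBoundedUnder_of_eventually_le hev).bddAbove_range
  refine ⟨K, ?_, fun n => ?_⟩
  · exact le_trans (by positivity) (hK ⟨0, rfl⟩)
  · have h : ‖a ^ n‖ / ε ^ n ≤ K := hK ⟨n, rfl⟩
    rwa [div_le_iff₀ (pow_pos hε n)] at h

theorem isQuasinilpotent_iff_isUnit [CompleteSpace R] {a : R} :
    IsQuasinilpotent a ↔ ∀ z : ℂ, IsUnit (1 + z • a) :=
  ⟨fun h => h.isUnit_one_add_smul, fun h => (hasSuperexpDecay_of_spectralRadius_eq_zero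
    (spectralRadius_eq_zero_of_isUnit h)).isQuasinilpotent⟩

theorem isQuasinilpotent_iff_norm_pow_le [CompleteSpace R] {a : R} :
    IsQuasinilpotent a ↔ HasSuperexpDecay a :=
  ⟨fun h => hasSuperexpDecay_of_spectralRadius_eq_zero
    (spectralRadius_eq_zero_of_isUnit h.isUnit_one_add_smul), fun h => h.isQuasinilpotent⟩

/-- The bound behind quasinilpotence of `a + b`. Passing `b` from the left of `(c • a + b) ^ n` to
its right multiplies `c` by `l`, so the estimate is stable under induction on `n` once it is stated
for all `c` in the unit disc and with arbitrary outer powers of `a` and `b`. -/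
theorem norm_pow_mul_add_pow_mul_pow_le {a b : R} {l : ℂ} (hl : ‖l‖ ≤ 1)
    (hab : b * a = l • (a * b)) {K L ε : ℝ} (hK : 0 ≤ K) (hε : 0 < ε)
    (ha : ∀ n : ℕ, ‖a ^ n‖ ≤ K * ε ^ n) (hb : ∀ n : ℕ, ‖b ^ n‖ ≤ L * ε ^ n) (n : ℕ) :
    ∀ (c : ℂ), ‖c‖ ≤ 1 → ∀ i j : ℕ,
      ‖a ^ i * (c • a + b) ^ n * b ^ j‖ ≤ K * L * (2 * ε) ^ n * ε ^ (i + j) := by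
  induction n with
  | zero =>
    intro c _ i j
    calc ‖a ^ i * (c • a + b) ^ 0 * b ^ j‖ ≤ ‖a ^ i‖ * ‖b ^ j‖ := by
          simpa using norm_mul_le (a ^ i) (b ^ j)
      _ ≤ (K * ε ^ i) * (L * ε ^ j) := by
          gcongr
          · exact ha i
          · exact hb j
      _ = _ := by ring
  | succ n ih =>
    intro c hc i j
    have hlc : ‖l * c‖ ≤ 1 := by
      rw [norm_mul]
      exact mul_le_one₀ hl (norm_nonneg _) hc
    have hcomm : b * (c • a + b) ^ n = ((l * c) • a + b) ^ n * b := by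
      have h : SemiconjBy b (c • a + b) ((l * c) • a + b) := by
        rw [SemiconjBy, mul_add, add_mul, mul_smul_comm, hab, smul_smul, smul_mul_assoc,
          _root_.mul_comm c l]
      exact h.pow_right n
    have hsplit : a ^ i * (c • a + b) ^ (n + 1) * b ^ j =
        c • (a ^ (i + 1) * (c • a + b) ^ n * b ^ j) +
          a ^ i * ((l * c) • a + b) ^ n * b ^ (j + 1) := by
      rw [pow_succ' (c • a + b), add_mul, hcomm, pow_succ a, pow_succ' b]
      simp only [mul_add, add_mul, smul_mul_assoc, mul_smul_comm, mul_assoc]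
    rw [hsplit]
    calc _ ≤ ‖c‖ * ‖a ^ (i + 1) * (c • a + b) ^ n * b ^ j‖ +
          ‖a ^ i * ((l * c) • a + b) ^ n * b ^ (j + 1)‖ := by
          refine (norm_add_le _ _).trans ?_
          rw [norm_smul]
      _ ≤ 1 * (K * L * (2 * ε) ^ n * ε ^ (i + 1 + j)) +
          K * L * (2 * ε) ^ n * ε ^ (i + (j + 1)) := by
          gcongr
          · exact ih c hc (i + 1) j
          · exact ih (l * c) hlc i (j + 1)
      _ = _ := by ring

variable [CompleteSpace R]

/-- Iterating gives `x = q ^ n * x * w ^ n`, whose norm tends to zero. -/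
theorem IsQuasinilpotent.eq_zero_of_eq_mul_mul {q x w : R} (hq : IsQuasinilpotent q)
    (h : x = q * x * w) : x = 0 := by
  have hn : ∀ n : ℕ, x = q ^ n * x * w ^ n := by
    intro n
    induction n with
    | zero => simp
    | succ n ih =>
      calc x = q * x * w := h
        _ = q * (q ^ n * x * w ^ n) * w := by rw [← ih]
        _ = q ^ (n + 1) * x * w ^ (n + 1) := by rw [pow_succ' q, pow_succ w]; noncomm_ring
  have ht := ((isQuasinilpotent_iff_norm_pow_le.1 hq).tendsto_mul_pow
    (norm_nonneg w)).mul_const ‖x‖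
  rw [zero_mul] at ht
  have hle : ‖x‖ ≤ 0 := by
    refine ge_of_tendsto ht ?_
    filter_upwards [Filter.eventually_gt_atTop 0] with n hn0
    calc ‖x‖ = ‖q ^ n * x * w ^ n‖ := by rw [← hn n]
      _ ≤ ‖q ^ n‖ * ‖x‖ * ‖w ^ n‖ := norm_mul₃_le
      _ ≤ ‖q ^ n‖ * ‖x‖ * ‖w‖ ^ n := by gcongr; exact norm_pow_le' w hn0
      _ = ‖q ^ n‖ * ‖w‖ ^ n * ‖x‖ := by ring
  exact norm_le_zero_iff.1 hle

theorem IsQuasinilpotent.eq_zero_of_eq_mul_mul' {q x w : R} (hq : IsQuasinilpotent q)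
    (h : x = w * x * q) : x = 0 := by
  have hn : ∀ n : ℕ, x = w ^ n * x * q ^ n := by
    intro n
    induction n with
    | zero => simp
    | succ n ih =>
      calc x = w * x * q := h
        _ = w * (w ^ n * x * q ^ n) * q := by rw [← ih]
        _ = w ^ (n + 1) * x * q ^ (n + 1) := by rw [pow_succ' w, pow_succ q]; noncomm_ring
  have ht := ((isQuasinilpotent_iff_norm_pow_le.1 hq).tendsto_mul_pow
    (norm_nonneg w)).mul_const ‖x‖
  rw [zero_mul] at ht
  have hle : ‖x‖ ≤ 0 := by
    refine ge_of_tendsto ht ?_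
    filter_upwards [Filter.eventually_gt_atTop 0] with n hn0
    calc ‖x‖ = ‖w ^ n * x * q ^ n‖ := by rw [← hn n]
      _ ≤ ‖w ^ n‖ * ‖x‖ * ‖q ^ n‖ := norm_mul₃_le
      _ ≤ ‖w‖ ^ n * ‖x‖ * ‖q ^ n‖ := by gcongr; exact norm_pow_le' w hn0
      _ = ‖q ^ n‖ * ‖w‖ ^ n * ‖x‖ := by ring
  exact norm_le_zero_iff.1 hle

theorem IsQuasinilpotent.mul_comm {x y : R} (h : IsQuasinilpotent (x * y)) :
    IsQuasinilpotent (y * x) := by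
  rw [isQuasinilpotent_iff_isUnit] at h ⊢
  intro z
  obtain ⟨u, hu⟩ := h z
  rw [← smul_mul_assoc] at hu
  rw [← mul_smul_comm]
  generalize z • x = x at *
  -- the inverse of `1 + y * x` is `1 - y * u⁻¹ * x`
  have h1 : (1 + x * y) * (↑u⁻¹ : R) = 1 := by rw [← hu]; simp
  have h2 : (↑u⁻¹ : R) * (1 + x * y) = 1 := by rw [← hu]; simp
  refine isUnit_iff_exists.2 ⟨1 - y * ↑u⁻¹ * x, ?_, ?_⟩
  · calc (1 + y * x) * (1 - y * (↑u⁻¹ : R) * x)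
        = 1 + y * x - y * ((1 + x * y) * (↑u⁻¹ : R)) * x := by noncomm_ring
      _ = 1 := by rw [h1]; simp
  · calc (1 - y * (↑u⁻¹ : R) * x) * (1 + y * x)
        = 1 + y * x - y * ((↑u⁻¹ : R) * (1 + x * y)) * x := by noncomm_ring
      _ = 1 := by rw [h2]; simp

theorem IsQuasinilpotent.of_mul_self {a : R} (h : IsQuasinilpotent (a * a)) :
    IsQuasinilpotent a := by
  rw [isQuasinilpotent_iff_isUnit] at h ⊢
  intro z
  have h1 := h (-(z * z))
  have h2 : 1 + (-(z * z)) • (a * a) = 1 - (z • a) * (z • a) := by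
    rw [smul_mul_smul_comm, neg_smul, sub_eq_add_neg]
  rw [h2] at h1
  generalize z • a = b at *
  have hc : Commute (1 + b) (1 - b) := by
    rw [Commute, SemiconjBy]
    noncomm_ring
  have h3 : 1 - b * b = (1 + b) * (1 - b) := by noncomm_ring
  rw [h3] at h1
  exact (hc.isUnit_mul_iff.1 h1).1

theorem IsQuasinilpotent.add_of_mul_eq_smul_mul_of_norm_le {a b : R} (ha : IsQuasinilpotent a)
    (hb : IsQuasinilpotent b) {l : ℂ} (hl : ‖l‖ ≤ 1) (hab : b * a = l • (a * b)) :
    IsQuasinilpotent (a + b) := by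
  rw [isQuasinilpotent_iff_norm_pow_le] at *
  intro ε hε
  obtain ⟨K, hK, hKa⟩ := ha (ε / 2) (by positivity)
  obtain ⟨L, hL, hLb⟩ := hb (ε / 2) (by positivity)
  refine ⟨K * L, mul_nonneg hK hL, fun n => ?_⟩
  have h := norm_pow_mul_add_pow_mul_pow_le hl hab hK (half_pos hε) hKa hLb n 1 (by simp) 0 0
  simpa [mul_div_cancel₀] using h

theorem IsQuasinilpotent.add_of_mul_eq_smul_mul {a b : R} (ha : IsQuasinilpotent a)
    (hb : IsQuasinilpotent b) {l : ℂ} (hl : l ≠ 0) (hab : b * a = l • (a * b)) :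
    IsQuasinilpotent (a + b) := by
  rcases le_total ‖l‖ 1 with h | h
  · exact ha.add_of_mul_eq_smul_mul_of_norm_le hb h hab
  · rw [add_comm]
    refine hb.add_of_mul_eq_smul_mul_of_norm_le ha (l := l⁻¹) ?_ ?_
    · rw [norm_inv]
      exact inv_le_one_of_one_le₀ h
    · rw [hab, smul_smul, inv_mul_cancel₀ hl, one_smul]

end Quasinilpotent

/-! ### Generalized Drazin inverses -/

namespace IsGDrazinInverse

theorem isGDrazinInvertible {R : Type*} [Ring R] {a b : R} (h : IsGDrazinInverse a b) :
    IsGDrazinInvertible a := ⟨b, h⟩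

theorem mul_mul_self {R : Type*} [Ring R] {a b : R} (h : IsGDrazinInverse a b) :
    a * (b * b) = b := by
  rw [← mul_assoc, ← h.comm, ← h.outer]

theorem self_mul_mul {R : Type*} [Ring R] {a b : R} (h : IsGDrazinInverse a b) :
    b * (b * a) = b := by
  rw [h.comm, ← mul_assoc, ← h.outer]

variable {R : Type*} [NormedRing R] [NormedAlgebra ℂ R] [CompleteSpace R]

theorem mul_mul_eq {a b c : R} (hb : IsGDrazinInverse a b) (hc : IsGDrazinInverse a c) :
    a * c * (a * b) = a * b ∧ a * b * (a * c) = a * b := by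
  have e1 := hb.mul_mul_self
  have e2 := hb.self_mul_mul
  have hq : a - a ^ 2 * c = a * (1 - a * c) := by noncomm_ring
  have hq' : a - a ^ 2 * c = (1 - a * c) * a := by
    rw [hq, mul_sub, sub_mul, mul_assoc a c a, hc.comm]
    simp
  have hidem : (1 - a * c) * (1 - a * c) = 1 - a * c := by
    have : a * c * (a * c) = a * c := by
      rw [mul_assoc, ← mul_assoc c, ← hc.outer]
    rw [mul_sub, sub_mul, sub_mul, this]
    simp
  constructor
  · have h : (1 - a * c) * (a * b) = 0 := by
      refine hc.quasinilpotent.eq_zero_of_eq_mul_mul (w := b) ?_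
      calc (1 - a * c) * (a * b) = (1 - a * c) * (1 - a * c) * (a * (a * (b * b))) := by
            rw [hidem, e1]
        _ = ((1 - a * c) * ((1 - a * c) * a)) * (a * b * b) := by noncomm_ring
        _ = ((1 - a * c) * (a * (1 - a * c))) * (a * b * b) := by rw [← hq', hq]
        _ = (a - a ^ 2 * c) * ((1 - a * c) * (a * b)) * b := by rw [hq']; noncomm_ring
    rw [sub_mul, one_mul, sub_eq_zero] at h
    exact h.symm
  · have h : (a * b) * (1 - a * c) = 0 := by
      refine hc.quasinilpotent.eq_zero_of_eq_mul_mul' (w := b) ?_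
      calc (a * b) * (1 - a * c) = (b * (b * a) * a) * ((1 - a * c) * (1 - a * c)) := by
            rw [hidem, e2, hb.comm]
        _ = (b * (b * a)) * (a * (1 - a * c)) * (1 - a * c) := by noncomm_ring
        _ = (b * (b * a)) * ((1 - a * c) * a) * (1 - a * c) := by rw [← hq, hq']
        _ = (b * (b * a)) * (1 - a * c) * (a * (1 - a * c)) := by noncomm_ring
        _ = b * ((a * b) * (1 - a * c)) * (a - a ^ 2 * c) := by rw [hq, hb.comm]; noncomm_ring
    rw [mul_sub, mul_one, sub_eq_zero] at h
    exact h.symm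

theorem unique {a b c : R} (hb : IsGDrazinInverse a b) (hc : IsGDrazinInverse a c) : b = c := by
  have h : a * b = a * c := by
    rw [← (mul_mul_eq hb hc).2, (mul_mul_eq hc hb).1]
  calc b = b * (a * b) := by rw [← mul_assoc]; exact hb.outer
    _ = b * (a * c) := by rw [h]
    _ = a * b * c := by rw [← mul_assoc, hb.comm]
    _ = c * a * c := by rw [h, hc.comm]
    _ = c := hc.outer.symm

theorem gDrazinInv_eq {a b : R} (h : IsGDrazinInverse a b) : gDrazinInv a = b := by
  have hex : IsGDrazinInvertible a := ⟨b, h⟩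
  rw [gDrazinInv, dif_pos hex]
  exact unique hex.choose_spec h

end IsGDrazinInverse

section Banach

variable {R : Type*} [NormedRing R] [NormedAlgebra ℂ R] [CompleteSpace R]

theorem IsGDrazinInvertible.isGDrazinInverse_gDrazinInv {R : Type*} [Ring R] {a : R}
    (h : IsGDrazinInvertible a) : IsGDrazinInverse a (gDrazinInv a) := by
  rw [gDrazinInv, dif_pos h]
  exact h.choose_spec

/-- Cline's formula. -/
theorem IsGDrazinInverse.cline {x y e : R} (h : IsGDrazinInverse (x * y) e) :
    IsGDrazinInverse (y * x) (y * (e * e) * x) := by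
  have e1 : x * y * (e * e) = e := h.mul_mul_self
  have e2 : e * (e * (x * y)) = e := h.self_mul_mul
  have hl : y * (e * e) * x * (y * x) = y * e * x := by
    calc _ = y * (e * (e * (x * y))) * x := by noncomm_ring
      _ = _ := by rw [e2]
  have hr : (y * x) * (y * (e * e) * x) = y * e * x := by
    calc _ = y * (x * y * (e * e)) * x := by noncomm_ring
      _ = _ := by rw [e1]
  refine ⟨by rw [hl, hr], ?_, ?_⟩
  · rw [hl]
    calc y * (e * e) * x = y * (e * (x * y * (e * e))) * x := by rw [e1]
      _ = y * e * x * (y * (e * e) * x) := by noncomm_ring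
  · have hq : y * x - (y * x) ^ 2 * (y * (e * e) * x) = y * ((1 - x * y * e) * x) := by
      rw [pow_two, mul_assoc (y * x), hr]
      noncomm_ring
    rw [hq]
    apply IsQuasinilpotent.mul_comm
    have h2 : (1 - x * y * e) * x * y = x * y - (x * y) ^ 2 * e := by
      calc _ = x * y - x * y * (e * (x * y)) := by noncomm_ring
        _ = _ := by rw [h.comm]; noncomm_ring
    rw [h2]
    exact h.quasinilpotent

/-! ### Twisted commutation -/

/-- The relation twisted by spectral idempotents reduces to commutation up to a scalar together
with one-sided orthogonality. -/
theorem IsGDrazinInverse.twisted_commute_of_eq_smul_spectral {R : Type*} [Ring R] [Algebra ℂ R]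
    {a b a' b' : R}
    (ha : IsGDrazinInverse a a') (hb : IsGDrazinInverse b b') {l : ℂ}
    (h : b * a = l • ((1 - b * b') * a * b * (1 - a * a'))) :
    b * a' = 0 ∧ b' * a = 0 ∧ b * a = l • (a * b) := by
  have h1 : b * a' = 0 := by
    have hz : (1 - a * a') * a' = 0 := by
      rw [sub_mul, one_mul, mul_assoc, ha.mul_mul_self, sub_self]
    calc b * a' = b * a * (a' * a') := by rw [mul_assoc, ha.mul_mul_self]
      _ = l • ((1 - b * b') * a * b * ((1 - a * a') * a') * a') := by
          rw [h, smul_mul_assoc]; noncomm_ring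
      _ = 0 := by rw [hz]; simp
  have h2 : b' * a = 0 := by
    have hz : b' * (1 - b * b') = 0 := by
      rw [mul_sub, mul_one, ← mul_assoc, ← hb.outer, sub_self]
    calc b' * a = b' * (b' * (b * a)) := by
          rw [← mul_assoc b' b, ← mul_assoc, hb.self_mul_mul]
      _ = l • (b' * (b' * (1 - b * b') * a * b * (1 - a * a'))) := by
          rw [h, mul_smul_comm, mul_smul_comm]; noncomm_ring
      _ = 0 := by rw [hz]; simp
  refine ⟨h1, h2, ?_⟩
  have h3 : (1 - b * b') * a = a := by
    rw [sub_mul, one_mul, mul_assoc, h2, mul_zero, sub_zero]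
  have h4 : b * (1 - a * a') = b := by
    rw [← ha.comm, mul_sub, mul_one, ← mul_assoc, h1, zero_mul, sub_zero]
  rwa [h3, mul_assoc, h4] at h

theorem IsGDrazinInverse.inv_mul_eq_zero {a b a' : R} (ha : IsGDrazinInverse a a') {l : ℂ}
    (hl : l ≠ 0) (h : b * a = l • (a * b)) (h1 : b * a' = 0) : a' * b = 0 := by
  have hab : a * b = l⁻¹ • (b * a) := by rw [h, smul_smul, inv_mul_cancel₀ hl, one_smul]
  have hb : b * (a - a ^ 2 * a') = b * a := by
    rw [pow_two, mul_assoc, ← ha.comm, mul_sub, ← mul_assoc a, ← ha.comm,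
      ← mul_assoc, ← mul_assoc, h1]
    simp
  refine ha.quasinilpotent.eq_zero_of_eq_mul_mul' (w := l⁻¹ • a') ?_
  calc a' * b = a' * (a' * (a * b)) := by
        rw [← mul_assoc a' a, ← mul_assoc, ha.self_mul_mul]
    _ = (l⁻¹ • a') * a' * (b * (a - a ^ 2 * a')) := by
        rw [hb, hab, mul_smul_comm, mul_smul_comm, smul_mul_assoc, smul_mul_assoc, mul_assoc]
    _ = _ := by noncomm_ring

theorem IsGDrazinInverse.mul_inv_eq_zero {a b b' : R} (hb : IsGDrazinInverse b b') {l : ℂ}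
    (hl : l ≠ 0) (h : b * a = l • (a * b)) (h1 : b' * a = 0) : a * b' = 0 := by
  have hab : a * b = l⁻¹ • (b * a) := by rw [h, smul_smul, inv_mul_cancel₀ hl, one_smul]
  have hb2 : (b - b ^ 2 * b') * a = b * a := by
    rw [sub_mul, mul_assoc, h1, mul_zero, sub_zero]
  refine hb.quasinilpotent.eq_zero_of_eq_mul_mul (w := l⁻¹ • b') ?_
  calc a * b' = a * b * (b' * b') := by rw [mul_assoc, hb.mul_mul_self]
    _ = ((b - b ^ 2 * b') * a) * b' * (l⁻¹ • b') := by
        rw [hb2, hab, mul_smul_comm, smul_mul_assoc, ← mul_assoc]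
    _ = _ := by noncomm_ring

theorem IsGDrazinInverse.add {a b a' b' : R} (ha : IsGDrazinInverse a a')
    (hb : IsGDrazinInverse b b') {l : ℂ} (hl : l ≠ 0) (h : b * a = l • (a * b))
    (h1 : b * a' = 0) (h2 : b' * a = 0) : IsGDrazinInverse (a + b) (a' + b') := by
  have h3 := ha.inv_mul_eq_zero hl h h1
  have h4 := hb.mul_inv_eq_zero hl h h2
  have hl' : (a' + b') * (a + b) = a * a' + b * b' := by
    rw [add_mul, mul_add, mul_add, h3, h2, ha.comm, hb.comm]
    simp
  have hr : (a + b) * (a' + b') = a * a' + b * b' := by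
    rw [add_mul, mul_add, mul_add, h1, h4]
    simp
  have ha2 : a ^ 2 * a' = a' * a ^ 2 := ((show Commute a' a from ha.comm).pow_right 2).symm
  have hb2 : b ^ 2 * b' = b' * b ^ 2 := ((show Commute b' b from hb.comm).pow_right 2).symm
  refine ⟨by rw [hl', hr], ?_, ?_⟩
  · rw [mul_assoc, hr]
    calc a' + b' = a' * a * a' + b' * b * b' := by rw [← ha.outer, ← hb.outer]
      _ = a' * a * a' + a' * b * b' + (b' * a * a' + b' * b * b') := by rw [h3, h2]; simp
      _ = _ := by noncomm_ring
  · have hsum : a + b - (a + b) ^ 2 * (a' + b') = (a - a ^ 2 * a') + (b - b ^ 2 * b') := by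
      have h5 : a * (b * b') = 0 := by rw [← hb.comm, ← mul_assoc, h4, zero_mul]
      have h6 : b * (a * a') = 0 := by rw [← ha.comm, ← mul_assoc, h1, zero_mul]
      rw [pow_two, mul_assoc, hr, add_mul, mul_add, mul_add, h5, h6]
      noncomm_ring
    rw [hsum]
    refine ha.quasinilpotent.add_of_mul_eq_smul_mul hb.quasinilpotent hl ?_
    have hba : (b - b ^ 2 * b') * (a - a ^ 2 * a') = b * a := by
      rw [sub_mul, mul_assoc (b ^ 2), mul_sub b', h2, mul_sub, ha2, ← mul_assoc b, h1,
        ← ha2, pow_two a, mul_assoc a a, ← mul_assoc b' a, h2]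
      simp
    have hab : (a - a ^ 2 * a') * (b - b ^ 2 * b') = a * b := by
      rw [sub_mul, mul_sub, hb2, ← mul_assoc a b', h4, ← hb2, mul_assoc (a ^ 2), mul_sub, h3,
        pow_two b, mul_assoc b b, ← mul_assoc a' b, h3]
      simp
    rw [hba, hab, h]

end Banach

/-! ### Two-by-two matrices -/

section Matrix

attribute [local instance] Matrix.linftyOpNormedRing Matrix.linftyOpNormedAlgebra

variable {R : Type*} [NormedRing R] [NormedAlgebra ℂ R] [CompleteSpace R]

/-- The uniformity of the operator norm is the product uniformity by definition, but instance
search does not unfold far enough to see it. -/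
theorem completeSpace_matrix {R : Type*} [NormedRing R] [CompleteSpace R] :
    @CompleteSpace (Matrix (Fin 2) (Fin 2) R) PseudoMetricSpace.toUniformSpace :=
  inferInstanceAs (CompleteSpace (Fin 2 → Fin 2 → R))

attribute [local instance] completeSpace_matrix

theorem isQuasinilpotent_diag {x y : R} (hx : IsQuasinilpotent x) (hy : IsQuasinilpotent y) :
    IsQuasinilpotent !![x, 0; 0, y] := by
  rw [isQuasinilpotent_iff_isUnit]
  intro z
  obtain ⟨u, hu⟩ := hx.isUnit_one_add_smul z
  obtain ⟨v, hv⟩ := hy.isUnit_one_add_smul z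
  have h : (1 : Matrix (Fin 2) (Fin 2) R) + z • !![x, 0; 0, y] = !![(u : R), 0; 0, (v : R)] := by
    rw [hu, hv, Matrix.one_fin_two]
    ext i j
    fin_cases i <;> fin_cases j <;> simp
  rw [h]
  refine isUnit_iff_exists.2 ⟨!![(↑u⁻¹ : R), 0; 0, (↑v⁻¹ : R)], ?_, ?_⟩ <;>
    simp [Matrix.one_fin_two]

theorem isGDrazinInverse_diag {x y x' y' : R} (hx : IsGDrazinInverse x x')
    (hy : IsGDrazinInverse y y') : IsGDrazinInverse !![x, 0; 0, y] !![x', 0; 0, y'] := by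
  refine ⟨?_, ?_, ?_⟩
  · simp [hx.comm, hy.comm]
  · simp [← hx.outer, ← hy.outer]
  · have h : !![x, 0; 0, y] - !![x, 0; 0, y] ^ 2 * !![x', 0; 0, y'] =
        !![x - x ^ 2 * x', 0; 0, y - y ^ 2 * y'] := by
      rw [pow_two, Matrix.mul_fin_two, Matrix.mul_fin_two]
      ext i j
      fin_cases i <;> fin_cases j <;> simp [pow_two]
    rw [h]
    exact isQuasinilpotent_diag hx.quasinilpotent hy.quasinilpotent

theorem isGDrazinInverse_antidiag {B C e f : R} (he : IsGDrazinInverse (B * C) e)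
    (hf : IsGDrazinInverse (C * B) f) :
    IsGDrazinInverse !![0, B; C, 0] !![0, B * f; C * e, 0] := by
  have hfe : f = C * (e * e) * B := hf.unique he.cline
  have hBf : B * f = e * B := by
    rw [hfe]
    calc _ = B * C * (e * e) * B := by noncomm_ring
      _ = _ := by rw [he.mul_mul_self]
  have hCe : C * e = f * C := by
    rw [hfe]
    calc _ = C * (e * (e * (B * C))) := by rw [he.self_mul_mul]
      _ = _ := by noncomm_ring
  have hQ : !![0, B; C, 0] * !![0, B * f; C * e, 0] = !![B * C * e, 0; 0, C * B * f] := by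
    simp [mul_assoc]
  have hQ' : !![0, B * f; C * e, 0] * !![0, B; C, 0] = !![B * C * e, 0; 0, C * B * f] := by
    rw [hBf, hCe, ← he.comm, ← hf.comm]
    simp [mul_assoc]
  refine ⟨by rw [hQ, hQ'], ?_, ?_⟩
  · rw [mul_assoc, hQ]
    have h1 : B * f * (C * B * f) = B * f := by
      rw [mul_assoc, ← mul_assoc f, ← hf.outer]
    have h2 : C * e * (B * C * e) = C * e := by
      rw [mul_assoc, ← mul_assoc e, ← he.outer]
    simp [h1, h2]
  · have hq : !![0, B; C, 0] - !![0, B; C, 0] ^ 2 * !![0, B * f; C * e, 0] =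
        !![0, B * (1 - C * B * f); C * (1 - B * C * e), 0] := by
      rw [pow_two, mul_assoc, hQ, Matrix.mul_fin_two]
      ext i j
      fin_cases i <;> fin_cases j <;> simp [mul_sub]
    rw [hq]
    apply IsQuasinilpotent.of_mul_self
    have hB : B * (1 - C * B * f) = (1 - B * C * e) * B := by
      calc _ = B - B * C * (B * f) := by noncomm_ring
        _ = _ := by rw [hBf]; noncomm_ring
    have hC : C * (1 - B * C * e) = (1 - C * B * f) * C := by
      calc _ = C - C * B * (C * e) := by noncomm_ring
        _ = _ := by rw [hCe]; noncomm_ring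
    have idem {x y : R} (h : IsGDrazinInverse x y) :
        x * (1 - x * y) * (1 - x * y) = x - x ^ 2 * y := by
      have h1 : x * y * (x * y) = x * y := by rw [mul_assoc, ← mul_assoc y, ← h.outer]
      calc _ = x * (1 - x * y - x * y + x * y * (x * y)) := by noncomm_ring
        _ = _ := by rw [h1]; noncomm_ring
    have hsq : !![0, B * (1 - C * B * f); C * (1 - B * C * e), 0] *
        !![0, B * (1 - C * B * f); C * (1 - B * C * e), 0] =
        !![B * C - (B * C) ^ 2 * e, 0; 0, C * B - (C * B) ^ 2 * f] := by
      have h1 : B * (1 - C * B * f) * (C * (1 - B * C * e)) = B * C - (B * C) ^ 2 * e := by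
        rw [← idem he, mul_assoc B, ← mul_assoc _ C, ← hC]
        noncomm_ring
      have h2 : C * (1 - B * C * e) * (B * (1 - C * B * f)) = C * B - (C * B) ^ 2 * f := by
        rw [← idem hf, mul_assoc C, ← mul_assoc _ B, ← hB]
        noncomm_ring
      rw [Matrix.mul_fin_two, h1, h2]
      simp
    rw [hsq]
    exact isQuasinilpotent_diag he.quasinilpotent hf.quasinilpotent

/-- The twisted additive result for matrices, for use where no norm on matrices is in scope. -/
theorem matrix_gDrazinInv_add {P Q P' Q' : Matrix (Fin 2) (Fin 2) R} (hP : IsGDrazinInverse P P')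
    (hQ : IsGDrazinInverse Q Q') {l : ℂ} (hl : l ≠ 0)
    (h : Q * P = l • ((1 - Q * Q') * P * Q * (1 - P * P'))) :
    P' * Q = 0 ∧ P * Q' = 0 ∧ IsGDrazinInverse (P + Q) (P' + Q') := by
  obtain ⟨h1, h2, h3⟩ := hP.twisted_commute_of_eq_smul_spectral hQ h
  exact ⟨hP.inv_mul_eq_zero hl h3 h1, hQ.mul_inv_eq_zero hl h3 h2, hP.add hQ hl h3 h1 h2⟩

theorem matrix_gDrazinInv_eq {a b : Matrix (Fin 2) (Fin 2) R} (h : IsGDrazinInverse a b) :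
    gDrazinInv a = b :=
  h.gDrazinInv_eq

end Matrix

end GDrazin

theorem theorem3p1 {𝒜 : Type*} [NormedRing 𝒜] [NormedAlgebra ℂ 𝒜] [CompleteSpace 𝒜]
    (A B C D : 𝒜) (l : ℂ) (hl : l ≠ 0)
    (hA : GDrazin.IsGDrazinInvertible A) (hD : GDrazin.IsGDrazinInvertible D)
    (hBC : GDrazin.IsGDrazinInvertible (B * C))
    (hBD : B * D = l • (GDrazin.spectralIdem (B * C) * A * B * GDrazin.spectralIdem D))
    (hCA : C * A = l • (GDrazin.spectralIdem (C * B) * D * C * GDrazin.spectralIdem A))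
    (M P Q : Matrix (Fin 2) (Fin 2) 𝒜)
    (hM : M = !![A, B; C, D]) (hP : P = !![A, 0; 0, D]) (hQ : Q = !![0, B; C, 0]) :
    -- the generalized Drazin inverses that occur in the formula exist
    GDrazin.IsGDrazinInvertible (C * B) ∧
    GDrazin.IsGDrazinInvertible P ∧
    GDrazin.IsGDrazinInvertible Q ∧
    GDrazin.IsGDrazinInvertible M ∧
    -- the series that occur in the formula converge
    Summable (fun n : ℕ =>
      GDrazin.gDrazinInv P ^ (n + 2) * Q * M ^ n * GDrazin.spectralIdem Q) ∧
    Summable (fun n : ℕ => M ^ n * P * GDrazin.gDrazinInv Q ^ (n + 2)) ∧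
    (∀ n : ℕ, Summable (fun k : ℕ =>
      GDrazin.gDrazinInv P ^ (k + 1) * Q * M ^ (n + k) * P *
        GDrazin.gDrazinInv Q ^ (n + 2))) ∧
    Summable (fun n : ℕ => ∑' k : ℕ,
      GDrazin.gDrazinInv P ^ (k + 1) * Q * M ^ (n + k) * P *
        GDrazin.gDrazinInv Q ^ (n + 2)) ∧
    Summable (fun n : ℕ =>
      GDrazin.gDrazinInv P ^ (n + 2) * Q * M ^ n * P * GDrazin.gDrazinInv Q) ∧
    -- the formula
    GDrazin.gDrazinInv M =
      !![GDrazin.gDrazinInv A * GDrazin.spectralIdem (B * C),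
          GDrazin.spectralIdem A * B * GDrazin.gDrazinInv (C * B);
         GDrazin.spectralIdem D * C * GDrazin.gDrazinInv (B * C),
          GDrazin.gDrazinInv D * GDrazin.spectralIdem (C * B)]
      + (∑' n : ℕ, GDrazin.gDrazinInv P ^ (n + 2) * Q * M ^ n * GDrazin.spectralIdem Q)
      + GDrazin.spectralIdem P * (∑' n : ℕ, M ^ n * P * GDrazin.gDrazinInv Q ^ (n + 2))
      - (∑' n : ℕ, ∑' k : ℕ,
          GDrazin.gDrazinInv P ^ (k + 1) * Q * M ^ (n + k) * P *
            GDrazin.gDrazinInv Q ^ (n + 2))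
      - (∑' n : ℕ,
          GDrazin.gDrazinInv P ^ (n + 2) * Q * M ^ n * P * GDrazin.gDrazinInv Q) := by
  have hA' := hA.isGDrazinInverse_gDrazinInv
  have hD' := hD.isGDrazinInverse_gDrazinInv
  have hBC' := hBC.isGDrazinInverse_gDrazinInv
  have hCB : GDrazin.IsGDrazinInvertible (C * B) := hBC'.cline.isGDrazinInvertible
  have hCB' := hCB.isGDrazinInverse_gDrazinInv
  have hP' := GDrazin.isGDrazinInverse_diag hA' hD'
  have hQ' := GDrazin.isGDrazinInverse_antidiag hBC' hCB'
  rw [← hP] at hP'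
  rw [← hQ] at hQ'
  have hMPQ : M = P + Q := by
    rw [hM, hP, hQ]
    ext i j
    fin_cases i <;> fin_cases j <;> simp
  unfold GDrazin.spectralIdem at *
  have hPd := GDrazin.matrix_gDrazinInv_eq hP'
  have hQd := GDrazin.matrix_gDrazinInv_eq hQ'
  generalize GDrazin.gDrazinInv A = a at *
  generalize GDrazin.gDrazinInv D = d at *
  generalize GDrazin.gDrazinInv (B * C) = e at *
  generalize GDrazin.gDrazinInv (C * B) = f at *
  -- the hypotheses on the entries, in matrix form
  have hQP : Q * P = l • ((1 - Q * !![0, B * f; C * e, 0]) * P * Q * (1 - P * !![a, 0; 0, d])) := by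
    rw [hP, hQ, Matrix.one_fin_two]
    ext i j
    fin_cases i <;> fin_cases j <;> simp [Matrix.mul_apply, Fin.sum_univ_two, hBD, hCA, mul_assoc]
  obtain ⟨hPQ, hQP', hMd⟩ := GDrazin.matrix_gDrazinInv_add hP' hQ' hl hQP
  rw [← hMPQ] at hMd
  rw [GDrazin.matrix_gDrazinInv_eq hMd, hPd, hQd]
  -- all terms of the series vanish because `Pᵈ * Q = 0` and `P * Qᵈ = 0`
  have hz1 (n : ℕ) : !![a, 0; 0, d] ^ (n + 1) * Q = 0 := by rw [pow_succ, mul_assoc, hPQ, mul_zero]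
  have hz2 (n : ℕ) (X : Matrix (Fin 2) (Fin 2) 𝒜) :
      X * P * !![0, B * f; C * e, 0] ^ (n + 2) = 0 := by
    rw [pow_succ', mul_assoc, ← mul_assoc P, hQP', zero_mul, mul_zero]
  refine ⟨hCB, hP'.isGDrazinInvertible, hQ'.isGDrazinInvertible, hMd.isGDrazinInvertible, ?_⟩
  simp only [hz1, hz2, zero_mul, mul_zero, tsum_zero, summable_zero, implies_true, true_and,
    add_zero, sub_zero]
  rw [hQ, Matrix.mul_fin_two] at hPQ
  -- the entries of `Pᵈ * Q = 0` remove the spectral idempotents from the leading matrix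
  have haB : a * B = 0 := by simpa using congrFun (congrFun hPQ 0) 1
  have hdC : d * C = 0 := by simpa using congrFun (congrFun hPQ 1) 0
  have h1 : a * (1 - B * C * e) = a := by
    rw [mul_sub, mul_one, mul_assoc B, ← mul_assoc, haB, zero_mul, sub_zero]
  have h2 : d * (1 - C * B * f) = d := by
    rw [mul_sub, mul_one, mul_assoc C, ← mul_assoc, hdC, zero_mul, sub_zero]
  have h3 : (1 - A * a) * B = B := by
    rw [sub_mul, one_mul, mul_assoc, haB, mul_zero, sub_zero]
  have h4 : (1 - D * d) * C = C := by
    rw [sub_mul, one_mul, mul_assoc, hdC, mul_zero, sub_zero]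
  rw [h1, h2, h3, h4]
  ext i j
  fin_cases i <;> fin_cases j <;> simp
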